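/- Let $n\ge 1$. A convex body in $\mathbb{R}^n$ is a nonempty compact convex set $K$; its support function is $h(K,u)=\max\{\langle x,u\rangle : x\in K\}$, and $K$ has constant width $1$ if $h(K,u)+h(K,-u)=1$ for all $u\in\mathbb{S}^{n-1}$. Let $u\in\mathbb{S}^{n-1}$ be such that exactly one point $x\in K$ satisfies $\langle x,u\rangle=h(K,u)$ (for bodies of constant width this holds for every $u$), and let $t\in u^\perp\cap\mathbb{S}^{n-1}$. Let $\overline K$ be the orthogonal projection of $K$ to the plane $L=x+\mathrm{lin}\{u,t\}$ and let $E=\{x+\lambda u+\mu t:\lambda\in\mathbb{R},\ \mu>0\}$. For a point $z\neq x$ of the boundary of $\overline K$ relative to $L$, let $r(z)\in(0,\infty]$ be the radius of the circle in $L$ through $x$ and $z$ with centre on the ray $\{x-\rho u:\rho\ge 0\}$, with $r(z)=\infty$ if $\langle z-x,u\rangle=0$. The lower and upper tangential radii of curvature of $K$ at $u$ in direction $t$ are $\liminf r(z)$ and $\limsup r(z)$, as $z\to x$ with $z\in E\cap\mathrm{relbd}\,\overline K$; if both are equal, their common value in $[0,\infty]$ is the tangential radius of curvature $\bar\varrho(K,u,t)$.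 Theorem. Let $W_0\subset\mathbb{R}^n$ be a convex body of constant width $1$, let $v\in\mathbb{S}^{n-1}$ and $\varepsilon>0$. Then there exists a convex body $Q\subset\mathbb{R}^n$ of constant width $1$ whose Hausdorff distance from $W_0$ is at most $\varepsilon$ and which has the following property. For each $u\in\mathbb{S}^{n-1}$ with $\langle u,v\rangle\ge 1/2$, either $\bar\varrho(Q,u,t)$ exists and equals $1$ for all $t\in u^\perp\cap\mathbb{S}^{n-1}$, or $\bar\varrho(Q,u,t)$ exists and equals $0$ for at least one $t\in u^\perp\cap\mathbb{S}^{n-1}$. -/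

import Mathlib

open Filter Topology
open scoped ENNReal NNReal

noncomputable section

namespace ConstWidth

/-- Euclidean `n`-space. -/
abbrev Eu (n : ℕ) : Type := EuclideanSpace ℝ (Fin n)

variable {n : ℕ}

/-- The support function `h(K, u) = max {⟪x, u⟫ : x ∈ K}` (the supremum is attained since `K` is
nonempty and compact). -/
def supportFn (K : ConvexBody (Eu n)) (u : Eu n) : ℝ :=
  sSup ((fun x : Eu n => inner ℝ x u) '' (K : Set (Eu n)))

/-- `K` is a body of constant width `d`. -/
def HasConstantWidth (K : ConvexBody (Eu n)) (d : ℝ) : Prop :=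
  ∀ u : Eu n, ‖u‖ = 1 → supportFn K u + supportFn K (-u) = d

/-- The support set `F(K, u)`: the points of `K` in the supporting hyperplane with outer
normal vector `u`. -/
def supportSet (K : ConvexBody (Eu n)) (u : Eu n) : Set (Eu n) :=
  {x | x ∈ (K : Set (Eu n)) ∧ inner ℝ x u = supportFn K u}

/-- The radius `r(z)` of the unique circle through `x` and `z` whose centre `x - ρ u`, `ρ ≥ 0`, lies
on the ray from `x` in direction `-u` (for a unit vector `u`); it is `∞` if there is no such
circle, which is the case if `z ≠ x` lies on the line through `x` orthogonal to `u`. -/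
def circleRadius (x u z : Eu n) : ℝ≥0∞ :=
  ⨅ (ρ : ℝ≥0) (_ : dist z (x - (ρ : ℝ) • u) = ρ), (ρ : ℝ≥0∞)

/-- The open halfplane `{x + a u + b t : a ∈ ℝ, b > 0}`. -/
def openHalfplane (x u t : Eu n) : Set (Eu n) :=
  {y | ∃ a b : ℝ, 0 < b ∧ y = x + a • u + b • t}

/-- Lower radius of curvature at the support element `(x, u)` in direction `t` of a
two-dimensional convex set `P` lying in the plane `x + lin {u, t}`. The boundary of `P` is taken
relative to that plane. -/
def lowerRadius (P : Set (Eu n)) (x u t : Eu n) : ℝ≥0∞ :=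
  liminf (circleRadius x u) (𝓝[openHalfplane x u t ∩ intrinsicFrontier ℝ P] x)

/-- Upper radius of curvature at the support element `(x, u)` in direction `t` of a
two-dimensional convex set `P` lying in the plane `x + lin {u, t}`. -/
def upperRadius (P : Set (Eu n)) (x u t : Eu n) : ℝ≥0∞ :=
  limsup (circleRadius x u) (𝓝[openHalfplane x u t ∩ intrinsicFrontier ℝ P] x)

/-- The orthogonal projection of `K` to the affine plane `x + lin {u, t}`. -/
def planeProjection (K : ConvexBody (Eu n)) (x u t : Eu n) : Set (Eu n) :=
  (fun y : Eu n => x + (Submodule.span ℝ {u, t}).starProjection (y - x)) '' (K : Set (Eu n))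

/-- The unit vector `u` is a regular normal vector of `K` (the support set is a single point `x`),
and the tangential radius of curvature of `K` at `u` in direction `t` exists and equals `r`:
the lower and the upper radius of curvature, at `(x, u)` in direction `t`, of the projection of
`K` to `x + lin {u, t}` are both equal to `r`. -/
def TangentialRadiusEq (K : ConvexBody (Eu n)) (u t : Eu n) (r : ℝ≥0∞) : Prop :=
  ∃ x : Eu n, supportSet K u = {x} ∧
    lowerRadius (planeProjection K x u t) x u t = r ∧
    upperRadius (planeProjection K x u t) x u t = r

end ConstWidth

end

/-!
The set `C` of prescribed normal vectors may be any closed set of unit vectors without antipodal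
pairs, such as a spherical cap smaller than a hemisphere.

A slight Minkowski average of `W₀` with a ball of diameter one is a body `R` of constant width one
in which any two boundary points with normal vectors in a neighbourhood `N` of `C` are at distance
less than one, since points at distance one have opposite normal vectors. For a fine finite net `X`
of `R`, the intersection `P` of the unit balls with centres in `X` is close to `R`, so its boundary
points with normal vectors in `N` are still at mutual distance at most one. Hence these points and
`X` together form a set of diameter at most one, which is contained in a body `Q` of constant width
one. Since `X ⊆ Q ⊆ P`, the bodies `Q` and `R` are close, and `Q` and `P` have the same boundary
points with normal vectors in `N`. At such a point the boundary of `P` is either locally a unit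
sphere, and all tangential radii are one, or has several unit normal vectors; in that case some
projection of `Q` has a corner, and the corresponding tangential radius is zero.
-/

namespace ConstWidth

section NormalVectors

variable {E : Type*} [NormedAddCommGroup E] [InnerProductSpace ℝ E] {S T : Set E} {x y u : E}

/-- The vector `u` is an outer normal vector of `S` at the point `x` of `S`. The vector `u` need not
be normalized and may vanish. -/
def IsNormalAt (S : Set E) (x u : E) : Prop :=
  x ∈ S ∧ ∀ y ∈ S, inner ℝ y u ≤ inner ℝ x u

/-- The reverse spherical image `τ(S, N)`: the points of `S` with an outer normal vector in `N`. -/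
def reverseSphericalImage (S N : Set E) : Set E :=
  {x | ∃ u ∈ N, IsNormalAt S x u}

theorem exists_isNormalAt (hS : IsCompact S) (hne : S.Nonempty) (u : E) :
    ∃ x, IsNormalAt S x u := by
  obtain ⟨x, hx, hmax⟩ := hS.exists_isMaxOn hne (f := fun y => inner ℝ y u) (by fun_prop)
  exact ⟨x, hx, fun y hy => hmax hy⟩

namespace IsNormalAt

theorem mono (h : IsNormalAt S x u) (hTS : T ⊆ S) (hx : x ∈ T) : IsNormalAt T x u :=
  ⟨hx, fun y hy => h.2 y (hTS hy)⟩

open scoped Pointwise in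
theorem add (hx : IsNormalAt S x u) (hy : IsNormalAt T y u) : IsNormalAt (S + T) (x + y) u := by
  refine ⟨Set.add_mem_add hx.1 hy.1, ?_⟩
  rintro _ ⟨a, ha, b, hb, rfl⟩
  simpa only [inner_add_left] using add_le_add (hx.2 a ha) (hy.2 b hb)

open scoped Pointwise in
theorem smul (hx : IsNormalAt S x u) {r : ℝ} (hr : 0 ≤ r) : IsNormalAt (r • S) (r • x) u := by
  refine ⟨Set.smul_mem_smul_set hx.1, ?_⟩
  rintro _ ⟨a, ha, rfl⟩
  simpa only [real_inner_smul_left] using mul_le_mul_of_nonneg_left (hx.2 a ha) hr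

theorem notMem_interior (h : IsNormalAt S x u) (hu : u ≠ 0) : x ∉ interior S := by
  intro hx
  have hlim : Tendsto (fun s : ℝ => x + s • u) (𝓝[>] 0) (𝓝 x) := by
    have hcont : Continuous fun s : ℝ => x + s • u := by fun_prop
    simpa using (hcont.tendsto 0).mono_left nhdsWithin_le_nhds
  obtain ⟨s, hsS, hs⟩ :=
    ((hlim.eventually_mem (mem_interior_iff_mem_nhds.1 hx)).and self_mem_nhdsWithin).exists
  have hle := h.2 _ hsS
  rw [inner_add_left, real_inner_smul_left] at hle
  have := mul_pos (Set.mem_Ioi.1 hs) (real_inner_self_pos.2 hu)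
  linarith

end IsNormalAt

section Ball

variable {c : E} {r : ℝ}

theorem isNormalAt_of_subset_closedBall (hS : S ⊆ Metric.closedBall c r) (hx : x ∈ S)
    (hu : ‖u‖ = 1) (hxc : x - c = r • u) : IsNormalAt S x u := by
  refine ⟨hx, fun y hy => ?_⟩
  have hyc : inner ℝ (y - c) u ≤ r := by
    calc inner ℝ (y - c) u ≤ ‖y - c‖ * ‖u‖ := real_inner_le_norm _ _
      _ ≤ r := by rw [hu, mul_one]; exact mem_closedBall_iff_norm.1 (hS hy)
  have hxr : inner ℝ (x - c) u = r := by
    rw [hxc, real_inner_smul_left, real_inner_self_eq_norm_sq, hu, one_pow, mul_one]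
  rw [inner_sub_left] at hyc hxr
  linarith

theorem isNormalAt_closedBall (hr : 0 ≤ r) (hu : ‖u‖ = 1) :
    IsNormalAt (Metric.closedBall c r) (c + r • u) u :=
  isNormalAt_of_subset_closedBall subset_rfl
    (by simp [norm_smul, hu, abs_of_nonneg hr]) hu (add_sub_cancel_left _ _)

theorem eq_smul_of_norm_le_of_inner_eq {a : E} (hu : ‖u‖ = 1) (hr : ‖a‖ ≤ r)
    (ha : inner ℝ a u = r) : a = r • u := by
  have hr0 : 0 ≤ r := (norm_nonneg a).trans hr
  have hru : ‖r • u‖ = r := by rw [norm_smul, hu, mul_one, Real.norm_of_nonneg hr0]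
  apply eq_of_norm_le_re_inner_eq_norm_sq (𝕜 := ℝ) (hr.trans_eq hru.symm)
  rw [hru, RCLike.re_to_real, real_inner_smul_right, ha, sq]

theorem IsNormalAt.eq_of_closedBall (hr : 0 ≤ r) (hu : ‖u‖ = 1)
    (hx : IsNormalAt (Metric.closedBall c r) x u) : x = c + r • u := by
  have hle := mem_closedBall_iff_norm.1 hx.1
  have hinner : inner ℝ (x - c) u = r := by
    refine le_antisymm ((real_inner_le_norm _ _).trans (by rwa [hu, mul_one])) ?_
    have := hx.2 _ (isNormalAt_closedBall hr hu).1
    rw [inner_add_left, real_inner_smul_left, real_inner_self_eq_norm_sq, hu] at this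
    rw [inner_sub_left]
    linarith
  rw [← eq_smul_of_norm_le_of_inner_eq hu hle hinner, add_sub_cancel]

end Ball

theorem norm_sub_sq_le_of_inner_le {p : E} {δ : ℝ} (hu : ‖u‖ = 1)
    (hpx : inner ℝ x u ≤ inner ℝ p u) (h : ‖p - (x - u)‖ ≤ 1 + δ) :
    ‖p - x‖ ^ 2 ≤ 2 * δ + δ ^ 2 := by
  have hsq : ‖(p - x) + u‖ ^ 2 ≤ (1 + δ) ^ 2 := by
    rw [← sub_add] at h
    gcongr
  rw [norm_add_sq_real, hu, inner_sub_left] at hsq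
  linarith

end NormalVectors

section BallDual

/-- The ball dual of `X`: the points at distance at most one from all points of `X`. Thus
`X ⊆ ballDual X` says that the diameter of `X` is at most one, and `ballDual X = X` says in addition
that no point can be added to `X` without increasing its diameter beyond one. -/
def ballDual {F : Type*} [NormedAddCommGroup F] (X : Set F) : Set F :=
  ⋂ x ∈ X, Metric.closedBall x 1

section Normed

variable {F : Type*} [NormedAddCommGroup F] {S X : Set F} {y : F}

theorem mem_ballDual : y ∈ ballDual X ↔ ∀ x ∈ X, ‖y - x‖ ≤ 1 := by
  simp [ballDual, dist_eq_norm]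

theorem isClosed_ballDual : IsClosed (ballDual X) :=
  isClosed_biInter fun _ _ => Metric.isClosed_closedBall

theorem convex_ballDual [NormedSpace ℝ F] : Convex ℝ (ballDual X) :=
  convex_iInter₂ fun x _ => convex_closedBall x 1

theorem isCompact_ballDual [ProperSpace F] (hX : X.Nonempty) : IsCompact (ballDual X) := by
  obtain ⟨x, hx⟩ := hX
  exact (isCompact_closedBall x 1).of_isClosed_subset isClosed_ballDual
    (Set.biInter_subset_of_mem hx)

theorem exists_superset_ballDual_eq_self (hS : S ⊆ ballDual S) :
    ∃ Q, S ⊆ Q ∧ ballDual Q = Q := by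
  obtain ⟨Q, hSQ, hQ⟩ := zorn_subset_nonempty {T : Set F | T ⊆ ballDual T} (by
    intro C hC hchain _
    refine ⟨⋃₀ C, ?_, fun T hT => Set.subset_sUnion_of_mem hT⟩
    rintro x ⟨T, hT, hxT⟩
    refine mem_ballDual.2 ?_
    rintro y ⟨T', hT', hyT'⟩
    rcases hchain.total hT hT' with h | h
    · exact mem_ballDual.1 (hC hT' (h hxT)) y hyT'
    · exact mem_ballDual.1 (hC hT hxT) y (h hyT')) S hS
  refine ⟨Q, hSQ, Set.Subset.antisymm (fun z hz => ?_) hQ.prop⟩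
  have hinsert : insert z Q ⊆ ballDual (insert z Q) := by
    intro x hx
    refine mem_ballDual.2 fun y hy => ?_
    rcases hx with rfl | hx <;> rcases hy with rfl | hy
    · simp
    · exact mem_ballDual.1 hz y hy
    · rw [norm_sub_rev]
      exact mem_ballDual.1 hz x hx
    · exact mem_ballDual.1 (hQ.prop hx) y hy
  exact hQ.le_of_ge hinsert (Set.subset_insert z Q) (Set.mem_insert z Q)

theorem norm_sub_le_of_mem_ballDual {δ : ℝ} (hX : ∀ s ∈ S, ∃ x ∈ X, ‖s - x‖ ≤ δ)
    (hy : y ∈ ballDual X) {s : F} (hs : s ∈ S) : ‖y - s‖ ≤ 1 + δ := by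
  obtain ⟨x, hx, hsx⟩ := hX s hs
  calc ‖y - s‖ ≤ ‖y - x‖ + ‖x - s‖ := norm_sub_le_norm_sub_add_norm_sub y x s
    _ ≤ 1 + δ := add_le_add (mem_ballDual.1 hy x hx) (by rwa [norm_sub_rev])

theorem eventually_mem_ballDual (hX : X.Finite) (hy : y ∈ ballDual X) :
    ∀ᶠ z in 𝓝 y, (∀ i ∈ X, ‖y - i‖ = 1 → ‖z - i‖ ≤ 1) → z ∈ ballDual X := by
  have hinactive : ∀ᶠ z in 𝓝 y, ∀ i ∈ X, ‖y - i‖ < 1 → ‖z - i‖ < 1 := by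
    refine hX.eventually_all.2 fun i _ => ?_
    by_cases hi : ‖y - i‖ < 1
    · have hcont : Continuous fun z : F => ‖z - i‖ := by fun_prop
      filter_upwards [hcont.continuousAt.eventually_lt continuousAt_const hi] with z hz _ using hz
    · exact Eventually.of_forall fun _ h => absurd h hi
  filter_upwards [hinactive] with z hz hactive
  refine mem_ballDual.2 fun i hi => ?_
  rcases (mem_ballDual.1 hy i hi).lt_or_eq with hlt | heq
  · exact (hz i hi hlt).le
  · exact hactive i hi heq

end Normed

variable {E : Type*} [NormedAddCommGroup E] [InnerProductSpace ℝ E] {X : Set E} {x u z : E}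

theorem norm_one_sub_smul_add_smul_sq (a b : E) (s : ℝ) :
    ‖(1 - s) • a + s • b‖ ^ 2 =
      (1 - s) * ‖a‖ ^ 2 + s * ‖b‖ ^ 2 - s * (1 - s) * ‖b - a‖ ^ 2 := by
  rw [norm_add_sq_real, norm_sub_sq_real, norm_smul, norm_smul, mul_pow, mul_pow, Real.norm_eq_abs,
    Real.norm_eq_abs, sq_abs, sq_abs, real_inner_smul_left, real_inner_smul_right,
    real_inner_comm b a]
  ring

/-- This is the uniform convexity that `ballDual X` inherits from the unit balls. -/
theorem closedBall_subset_ballDual (hx : x ∈ ballDual X) (hz : z ∈ ballDual X) {s : ℝ}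
    (hs : s ∈ Set.Icc (0 : ℝ) 1) :
    Metric.closedBall ((1 - s) • x + s • z) (s * (1 - s) * ‖z - x‖ ^ 2 / 2) ⊆ ballDual X := by
  intro y hy
  refine mem_ballDual.2 fun i hi => ?_
  set m := (1 - s) • x + s • z
  set κ := s * (1 - s) * ‖z - x‖ ^ 2 / 2 with hκ
  have hxi : ‖x - i‖ ^ 2 ≤ 1 := pow_le_one₀ (norm_nonneg _) (mem_ballDual.1 hx i hi)
  have hzi : ‖z - i‖ ^ 2 ≤ 1 := pow_le_one₀ (norm_nonneg _) (mem_ballDual.1 hz i hi)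
  have hmi : ‖m - i‖ ^ 2 ≤ 1 - 2 * κ := by
    have hcomb : m - i = (1 - s) • (x - i) + s • (z - i) := by module
    rw [hcomb, norm_one_sub_smul_add_smul_sq, sub_sub_sub_cancel_right, hκ]
    nlinarith [hs.1, hs.2]
  have hκ1 : 0 ≤ 1 - κ := by linarith [sq_nonneg ‖m - i‖]
  have hm : ‖m - i‖ ≤ 1 - κ :=
    (sq_le_sq₀ (norm_nonneg _) hκ1).1 (by linarith [sq_nonneg κ, sub_sq 1 κ])
  calc ‖y - i‖ ≤ ‖y - m‖ + ‖m - i‖ := norm_sub_le_norm_sub_add_norm_sub y m i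
    _ ≤ κ + (1 - κ) := add_le_add (mem_closedBall_iff_norm.1 hy) hm
    _ = 1 := by ring

/-- The balls inside `ballDual X` about the points of the segment from `x` to `z` do not cross the
supporting hyperplane at `x`; to first order at `x`, this is the claim. -/
theorem IsNormalAt.norm_sub_le_of_mem_ballDual (hu : ‖u‖ = 1) (hx : IsNormalAt (ballDual X) x u)
    (hz : z ∈ ballDual X) : ‖z - (x - u)‖ ≤ 1 := by
  set g := inner ℝ (z - x) u
  set D := ‖z - x‖ ^ 2
  have hsegment : ∀ s ∈ Set.Ioo (0 : ℝ) 1, g + (1 - s) * D / 2 ≤ 0 := by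
    intro s hs
    have hκ : 0 ≤ s * (1 - s) * D / 2 := by
      have := sub_nonneg.2 hs.2.le
      have := hs.1.le
      positivity
    have hle := hx.2 _ (closedBall_subset_ballDual hx.1 hz (Set.Ioo_subset_Icc_self hs)
      (isNormalAt_closedBall hκ hu).1)
    have hpoint : (1 - s) • x + s • z + (s * (1 - s) * D / 2) • u =
      x + (s • (z - x) + (s * (1 - s) * D / 2) • u) := by module
    rw [hpoint, inner_add_left, inner_add_left, real_inner_smul_left, real_inner_smul_left,
      real_inner_self_eq_norm_sq, hu] at hle
    exact nonpos_of_mul_nonpos_right (a := s) (by linarith) hs.1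
  have hlim : Tendsto (fun s : ℝ => g + (1 - s) * D / 2) (𝓝[>] 0) (𝓝 (g + (1 - 0) * D / 2)) :=
    (Continuous.tendsto (by fun_prop) 0).mono_left nhdsWithin_le_nhds
  have hg : g + (1 - 0) * D / 2 ≤ 0 :=
    le_of_tendsto hlim (mem_of_superset (Ioo_mem_nhdsGT one_pos) hsegment)
  have hsq : ‖z - (x - u)‖ ^ 2 ≤ 1 := by
    rw [← sub_add, norm_add_sq_real, hu]
    linarith
  exact (sq_le_one_iff₀ (norm_nonneg _)).1 hsq

end BallDual

section ConstantWidth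

variable {n : ℕ} {K L : ConvexBody (Eu n)} {d e : ℝ} {x y u w : Eu n}

theorem IsNormalAt.supportFn_eq (hx : IsNormalAt (K : Set (Eu n)) x u) :
    supportFn K u = inner ℝ x u :=
  IsGreatest.csSup_eq ⟨⟨x, hx.1, rfl⟩, Set.forall_mem_image.2 hx.2⟩

theorem exists_isNormalAt_convexBody (K : ConvexBody (Eu n)) (u : Eu n) :
    ∃ x, IsNormalAt (K : Set (Eu n)) x u :=
  exists_isNormalAt K.isCompact K.nonempty u

theorem inner_le_supportFn (hx : x ∈ K) (u : Eu n) : inner ℝ x u ≤ supportFn K u := by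
  obtain ⟨y, hy⟩ := exists_isNormalAt_convexBody K u
  exact hy.supportFn_eq ▸ hy.2 x hx

theorem supportFn_add (K L : ConvexBody (Eu n)) (u : Eu n) :
    supportFn (K + L) u = supportFn K u + supportFn L u := by
  obtain ⟨x, hx⟩ := exists_isNormalAt_convexBody K u
  obtain ⟨y, hy⟩ := exists_isNormalAt_convexBody L u
  have hxy : IsNormalAt ((K + L : ConvexBody (Eu n)) : Set (Eu n)) (x + y) u := hx.add hy
  rw [hxy.supportFn_eq, hx.supportFn_eq, hy.supportFn_eq, inner_add_left]

theorem supportFn_smul (K : ConvexBody (Eu n)) {r : ℝ} (hr : 0 ≤ r) (u : Eu n) :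
    supportFn (r • K) u = r * supportFn K u := by
  obtain ⟨x, hx⟩ := exists_isNormalAt_convexBody K u
  have hrx : IsNormalAt ((r • K : ConvexBody (Eu n)) : Set (Eu n)) (r • x) u := hx.smul hr
  rw [hrx.supportFn_eq, hx.supportFn_eq, real_inner_smul_left]

/-- The closed ball as a convex body, to be used as a Minkowski summand. -/
def closedBallBody (c : Eu n) {r : ℝ} (hr : 0 ≤ r) : ConvexBody (Eu n) where
  carrier := Metric.closedBall c r
  convex' := convex_closedBall c r
  isCompact' := isCompact_closedBall c r
  nonempty' := Metric.nonempty_closedBall.2 hr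

theorem supportFn_closedBallBody (c : Eu n) {r : ℝ} (hr : 0 ≤ r) (hu : ‖u‖ = 1) :
    supportFn (closedBallBody c hr) u = inner ℝ c u + r := by
  have h : IsNormalAt (closedBallBody c hr : Set (Eu n)) (c + r • u) u :=
    isNormalAt_closedBall hr hu
  rw [h.supportFn_eq, inner_add_left, real_inner_smul_left, real_inner_self_eq_norm_sq, hu, one_pow,
    mul_one]

theorem hasConstantWidth_closedBallBody (c : Eu n) {r : ℝ} (hr : 0 ≤ r) :
    HasConstantWidth (closedBallBody c hr) (r + r) := by
  intro u hu
  rw [supportFn_closedBallBody c hr hu, supportFn_closedBallBody c hr (by rwa [norm_neg]),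
    inner_neg_right]
  ring

theorem hasConstantWidth_one_of_ballDual_eq (hK : ballDual (K : Set (Eu n)) = K) :
    HasConstantWidth K 1 := by
  intro u hu
  obtain ⟨x, hx⟩ := exists_isNormalAt_convexBody K u
  have hxu : x - u ∈ (K : Set (Eu n)) := by
    rw [← hK, mem_ballDual]
    intro z hz
    rw [norm_sub_rev]
    rw [← hK] at hx hz
    exact hx.norm_sub_le_of_mem_ballDual hu hz
  have hnormal : IsNormalAt (K : Set (Eu n)) (x - u) (-u) := by
    refine isNormalAt_of_subset_closedBall (c := x) (r := 1) (fun z hz => ?_) hxu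
      (by rwa [norm_neg]) (by rw [one_smul, sub_sub_cancel_left])
    rw [← hK] at hz
    exact mem_closedBall_iff_norm.2 (mem_ballDual.1 hz x hx.1)
  rw [hx.supportFn_eq, hnormal.supportFn_eq, inner_sub_left, inner_neg_right, inner_neg_right,
    real_inner_self_eq_norm_sq, hu]
  ring

theorem exists_superset_hasConstantWidth_one {S : Set (Eu n)} (hne : S.Nonempty)
    (hS : S ⊆ ballDual S) : ∃ Q : ConvexBody (Eu n), S ⊆ Q ∧ HasConstantWidth Q 1 := by
  obtain ⟨Q, hSQ, hQ⟩ := exists_superset_ballDual_eq_self hS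
  have hQne := hne.mono hSQ
  exact ⟨⟨Q, hQ ▸ convex_ballDual, hQ ▸ isCompact_ballDual hQne, hQne⟩, hSQ,
    hasConstantWidth_one_of_ballDual_eq hQ⟩

namespace HasConstantWidth

theorem add (hK : HasConstantWidth K d) (hL : HasConstantWidth L e) :
    HasConstantWidth (K + L) (d + e) := by
  intro u hu
  rw [supportFn_add, supportFn_add, add_add_add_comm, hK u hu, hL u hu]

theorem smul (hK : HasConstantWidth K d) {r : ℝ} (hr : 0 ≤ r) :
    HasConstantWidth (r • K) (r * d) := by
  intro u hu
  rw [supportFn_smul K hr, supportFn_smul K hr, ← mul_add, hK u hu]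

theorem norm_sub_le (hK : HasConstantWidth K 1) (hx : x ∈ K) (hy : y ∈ K) : ‖x - y‖ ≤ 1 := by
  rcases eq_or_ne (x - y) 0 with h0 | h0
  · simp [h0]
  set u := ‖x - y‖⁻¹ • (x - y) with hu
  have hxu := inner_le_supportFn hx u
  have hyu := inner_le_supportFn hy (-u)
  have hnorm : inner ℝ (x - y) u = ‖x - y‖ := by
    rw [hu, real_inner_smul_right, real_inner_self_eq_norm_mul_norm,
      inv_mul_cancel_left₀ (norm_ne_zero_iff.2 h0)]
  have hwidth := hK u (norm_smul_inv_norm h0)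
  rw [inner_neg_right] at hyu
  rw [inner_sub_left] at hnorm
  linarith

theorem sub_mem (hK : HasConstantWidth K 1) (hu : ‖u‖ = 1) (hx : IsNormalAt (K : Set (Eu n)) x u) :
    x - u ∈ K := by
  obtain ⟨y, hy⟩ := exists_isNormalAt_convexBody K (-u)
  have hinner : inner ℝ (x - y) u = 1 := by
    rw [← hK u hu, hx.supportFn_eq, hy.supportFn_eq, inner_sub_left, inner_neg_right,
      sub_eq_add_neg]
  have hxy : x - y = u := by
    rw [eq_smul_of_norm_le_of_inner_eq hu (hK.norm_sub_le hx.1 hy.1) hinner, one_smul]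
  rw [← hxy, sub_sub_cancel]
  exact hy.1

theorem eq_of_isNormalAt (hK : HasConstantWidth K 1) (hu : ‖u‖ = 1)
    (hx : IsNormalAt (K : Set (Eu n)) x u) (hy : IsNormalAt (K : Set (Eu n)) y u) : y = x := by
  have hinner : inner ℝ (y - (x - u)) u = 1 := by
    rw [inner_sub_left, inner_sub_left, real_inner_self_eq_norm_sq, hu,
      (hx.2 y hy.1).antisymm (hy.2 x hx.1)]
    ring
  have := eq_smul_of_norm_le_of_inner_eq hu (hK.norm_sub_le hy.1 (hK.sub_mem hu hx)) hinner
  rwa [one_smul, ← sub_add, add_eq_right, sub_eq_zero] at this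

theorem supportSet_eq_singleton (hK : HasConstantWidth K 1) (hu : ‖u‖ = 1)
    (hx : IsNormalAt (K : Set (Eu n)) x u) : supportSet K u = {x} := by
  ext y
  refine ⟨fun ⟨hy, hyu⟩ => hK.eq_of_isNormalAt hu hx ⟨hy, fun z hz => ?_⟩, ?_⟩
  · exact hyu ▸ inner_le_supportFn hz u
  · rintro rfl
    exact ⟨hx.1, hx.supportFn_eq.symm⟩

theorem half_le_inner (hK : HasConstantWidth K 1) (hu : ‖u‖ = 1) (hw : ‖w‖ = 1)
    (hxu : IsNormalAt (K : Set (Eu n)) x u) (hxw : IsNormalAt (K : Set (Eu n)) x w) :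
    1 / 2 ≤ inner ℝ w u := by
  have hle := hK.norm_sub_le (hK.sub_mem hu hxu) (hK.sub_mem hw hxw)
  rw [sub_sub_sub_cancel_left] at hle
  have hsq : ‖w - u‖ ^ 2 ≤ 1 := pow_le_one₀ (norm_nonneg _) hle
  rw [norm_sub_sq_real, hu, hw] at hsq
  linarith

theorem exists_mem_norm_sub_le (hK : HasConstantWidth K 1) {z : Eu n} {δ : ℝ} (hδ : 0 ≤ δ)
    (hz : ∀ y ∈ K, ‖z - y‖ ≤ 1 + δ) : ∃ y ∈ K, ‖z - y‖ ≤ δ := by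
  obtain ⟨q, hq, hmin⟩ := exists_norm_eq_iInf_of_complete_convex K.nonempty
    K.isCompact.isComplete K.convex z
  rw [norm_eq_iInf_iff_real_inner_le_zero K.convex hq] at hmin
  refine ⟨q, hq, ?_⟩
  rcases eq_or_ne (z - q) 0 with h0 | h0
  · rwa [h0, norm_zero]
  set u := ‖z - q‖⁻¹ • (z - q) with hu
  have hu1 : ‖u‖ = 1 := norm_smul_inv_norm h0
  have hqu : IsNormalAt (K : Set (Eu n)) q u := by
    refine ⟨hq, fun y hy => ?_⟩
    rw [← sub_nonpos, ← inner_sub_left, hu, real_inner_smul_right, real_inner_comm]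
    exact mul_nonpos_of_nonneg_of_nonpos (by positivity) (hmin y hy)
  have hzq : z - (q - u) = (‖z - q‖ + 1) • u := by
    rw [add_smul, one_smul, hu, smul_inv_smul₀ (norm_ne_zero_iff.2 h0), ← sub_add]
  have hle := hz _ (hK.sub_mem hu1 hqu)
  rw [hzq, norm_smul, hu1, mul_one, Real.norm_of_nonneg (by positivity)] at hle
  linarith

end HasConstantWidth

end ConstantWidth

section IntrinsicFrontier

variable {F : Type*} [NormedAddCommGroup F] [NormedSpace ℝ F] {P U : Set F} {p d : F}

theorem mem_intrinsicFrontier_of_ray (hp : p ∈ P) (hd : ∀ s : ℝ, p + s • d ∈ affineSpan ℝ P)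
    (hout : ∀ s : ℝ, 0 < s → p + s • d ∉ P) : p ∈ intrinsicFrontier ℝ P := by
  set f : ℝ → affineSpan ℝ P := fun s => ⟨p + s • d, hd s⟩ with hf
  have hfc : Continuous f := by fun_prop
  have hf0 : ((f 0 : affineSpan ℝ P) : F) = p := by simp [hf]
  refine mem_intrinsicFrontier.2 ⟨f 0, ⟨subset_closure (by simpa [hf0] using hp), fun hint => ?_⟩,
    hf0⟩
  have hnear : ∀ᶠ s in 𝓝[>] (0 : ℝ), f s ∈ ((↑) ⁻¹' P : Set (affineSpan ℝ P)) :=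
    nhdsWithin_le_nhds (hfc.continuousAt.eventually_mem (mem_interior_iff_mem_nhds.1 hint))
  obtain ⟨s, hsP, hs⟩ := (hnear.and self_mem_nhdsWithin).exists
  exact hout s hs hsP

theorem notMem_intrinsicFrontier_of_inter_subset {L : AffineSubspace ℝ F} (hPL : P ⊆ L)
    (hU : U ∈ 𝓝 p) (hUL : U ∩ L ⊆ P) : p ∉ intrinsicFrontier ℝ P := by
  rintro ⟨y, hy, rfl⟩
  refine hy.2 (mem_interior_iff_mem_nhds.2 (mem_of_superset
    (continuous_subtype_val.continuousAt.preimage_mem_nhds hU) fun z hz => ?_))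
  exact hUL ⟨hz, affineSpan_le.2 hPL z.2⟩

end IntrinsicFrontier

theorem eventually_mem_of_eventually_mem_sphere {F : Type*} [NormedAddCommGroup F]
    [NormedSpace ℝ F] {S : Set F} {c x : F} (hS : Convex ℝ S) (hc : c ∈ S) (hxc : x ≠ c)
    (h : ∀ᶠ y in 𝓝 x, ‖y - c‖ = ‖x - c‖ → y ∈ S) :
    ∀ᶠ y in 𝓝 x, ‖y - c‖ ≤ ‖x - c‖ → y ∈ S := by
  have hr : ‖x - c‖ ≠ 0 := norm_ne_zero_iff.2 (sub_ne_zero.2 hxc)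
  have hradial : Tendsto (fun y => c + (‖x - c‖ / ‖y - c‖) • (y - c)) (𝓝 x) (𝓝 x) := by
    have hcont : ContinuousAt (fun y => c + (‖x - c‖ / ‖y - c‖) • (y - c)) x := by
      fun_prop (disch := assumption)
    simpa [hr] using hcont.tendsto
  filter_upwards [hradial.eventually h, eventually_ne_nhds hxc] with y hy hyc hle
  have hyr : ‖y - c‖ ≠ 0 := norm_ne_zero_iff.2 (sub_ne_zero.2 hyc)
  have hsphere : c + (‖x - c‖ / ‖y - c‖) • (y - c) ∈ S := by
    apply hy
    rw [add_sub_cancel_left, norm_smul, Real.norm_of_nonneg (by positivity), div_mul_cancel₀ _ hyr]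
  have hcomb := hS.add_smul_sub_mem hc hsphere (t := ‖y - c‖ / ‖x - c‖)
    ⟨by positivity, div_le_one_of_le₀ hle (norm_nonneg _)⟩
  rwa [add_sub_cancel_left, smul_smul, div_mul_div_cancel₀ hr, div_self hyr, one_smul,
    add_sub_cancel] at hcomb

section OrthonormalPair

variable {E : Type*} [NormedAddCommGroup E] [InnerProductSpace ℝ E] {x u t w : E}

theorem norm_smul_add_smul_sq (hu : ‖u‖ = 1) (ht : ‖t‖ = 1) (htu : inner ℝ t u = 0) (a b : ℝ) :
    ‖a • u + b • t‖ ^ 2 = a ^ 2 + b ^ 2 := by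
  rw [norm_add_sq_real, norm_smul, norm_smul, hu, ht, real_inner_smul_left, real_inner_smul_right,
    real_inner_comm, htu]
  simp

theorem dist_smul_add_smul_eq_iff (hu : ‖u‖ = 1) (ht : ‖t‖ = 1) (htu : inner ℝ t u = 0)
    {a b r : ℝ} (hr : 0 ≤ r) :
    dist (x + a • u + b • t) (x - r • u) = r ↔ a ^ 2 + b ^ 2 + 2 * a * r = 0 := by
  have hsub : x + a • u + b • t - (x - r • u) = (a + r) • u + b • t := by module
  rw [dist_eq_norm, hsub, ← sq_eq_sq₀ (norm_nonneg _) hr, norm_smul_add_smul_sq hu ht htu]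
  constructor <;> intro h <;> linarith

theorem inner_smul_add_smul_left (hu : ‖u‖ = 1) (htu : inner ℝ t u = 0) (a b : ℝ) :
    inner ℝ (a • u + b • t) u = a := by
  simp [inner_add_left, real_inner_smul_left, htu, hu]

theorem inner_smul_add_smul_right (ht : ‖t‖ = 1) (htu : inner ℝ t u = 0) (a b : ℝ) :
    inner ℝ (a • u + b • t) t = b := by
  rw [real_inner_comm] at htu
  simp [inner_add_left, real_inner_smul_left, htu, ht]

theorem inner_sq_add_inner_sq_le (hu : ‖u‖ = 1) (ht : ‖t‖ = 1) (htu : inner ℝ t u = 0) (w : E) :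
    inner ℝ w u ^ 2 + inner ℝ w t ^ 2 ≤ ‖w‖ ^ 2 := by
  have hsq := norm_sub_sq_real w (inner ℝ w u • u + inner ℝ w t • t)
  rw [norm_smul_add_smul_sq hu ht htu, inner_add_right, real_inner_smul_right,
    real_inner_smul_right] at hsq
  linarith [sq_nonneg ‖w - (inner ℝ w u • u + inner ℝ w t • t)‖]

theorem exists_orthonormal_eq_add_smul (hu : ‖u‖ = 1) (hw : w ≠ inner ℝ w u • u) :
    ∃ t : E, ‖t‖ = 1 ∧ inner ℝ t u = 0 ∧ ∃ b : ℝ, 0 < b ∧ w = inner ℝ w u • u + b • t := by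
  have hne := sub_ne_zero.2 hw
  refine ⟨‖w - inner ℝ w u • u‖⁻¹ • (w - inner ℝ w u • u), norm_smul_inv_norm hne, ?_,
    ‖w - inner ℝ w u • u‖, norm_pos_iff.2 hne, ?_⟩
  · rw [real_inner_smul_left, inner_sub_left, real_inner_smul_left, real_inner_self_eq_norm_sq, hu]
    simp
  · rw [smul_inv_smul₀ (norm_ne_zero_iff.2 hne), add_sub_cancel]

theorem starProjection_span_pair (hu : ‖u‖ = 1) (ht : ‖t‖ = 1) (htu : inner ℝ t u = 0)
    [(Submodule.span ℝ {u, t}).HasOrthogonalProjection] (w : E) :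
    (Submodule.span ℝ {u, t}).starProjection w = inner ℝ w u • u + inner ℝ w t • t := by
  refine Submodule.eq_starProjection_of_mem_of_inner_eq_zero
    (Submodule.mem_span_pair.2 ⟨_, _, rfl⟩) fun v hv => ?_
  obtain ⟨a, b, rfl⟩ := Submodule.mem_span_pair.1 hv
  rw [inner_sub_left, inner_add_right, inner_add_right, real_inner_smul_right,
    real_inner_smul_right, real_inner_smul_right, real_inner_smul_right,
    inner_smul_add_smul_left hu htu, inner_smul_add_smul_right ht htu, sub_self]

end OrthonormalPair

section PlaneProjection

variable {n : ℕ} {K : ConvexBody (Eu n)} {x u t : Eu n} {a b : ℝ}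

theorem circleRadius_eq (hu : ‖u‖ = 1) (ht : ‖t‖ = 1) (htu : inner ℝ t u = 0) (ha : a < 0) :
    circleRadius x u (x + a • u + b • t) = ENNReal.ofReal ((a ^ 2 + b ^ 2) / (-2 * a)) := by
  have hpos : 0 ≤ (a ^ 2 + b ^ 2) / (-2 * a) := div_nonneg (by positivity) (by linarith)
  have hunique : ∀ r : ℝ≥0, dist (x + a • u + b • t) (x - (r : ℝ) • u) = r ↔
      r = ((a ^ 2 + b ^ 2) / (-2 * a)).toNNReal := by
    intro r
    rw [dist_smul_add_smul_eq_iff hu ht htu r.coe_nonneg, ← NNReal.coe_inj,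
      Real.coe_toNNReal _ hpos, eq_div_iff (by linarith)]
    constructor <;> intro h <;> linarith
  simp only [circleRadius, hunique, iInf_iInf_eq_left]
  rfl

/-- Since `a * α + b * β ≤ 0` and `0 < β`, the quotient `β / -α` is at most `a / b`. -/
theorem circleRadius_le (hu : ‖u‖ = 1) (ht : ‖t‖ = 1) (htu : inner ℝ t u = 0) {α β : ℝ}
    (ha : 0 ≤ a) (hb : 0 < b) (hβ : 0 < β) (h : a * α + b * β ≤ 0) :
    circleRadius x u (x + α • u + β • t) ≤
      ENNReal.ofReal ((1 + (a / b) ^ 2) / 2 * ‖α • u + β • t‖) := by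
  have hα : α < 0 := by
    by_contra! hα
    linarith [mul_pos hb hβ, mul_nonneg ha hα]
  have hαnorm : -α ≤ ‖α • u + β • t‖ := by
    have hinner := abs_real_inner_le_norm (α • u + β • t) u
    rwa [inner_smul_add_smul_left hu htu, hu, mul_one, abs_of_neg hα] at hinner
  have hβα : β ^ 2 ≤ (a / b * -α) ^ 2 := by
    have : β ≤ a / b * -α := by
      rw [div_mul_eq_mul_div, le_div_iff₀ hb]
      linarith
    gcongr
  rw [circleRadius_eq hu ht htu hα]
  refine ENNReal.ofReal_le_ofReal ?_
  calc (α ^ 2 + β ^ 2) / (-2 * α) ≤ (1 + (a / b) ^ 2) / 2 * -α := by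
        rw [div_le_iff₀ (by linarith)]
        linarith
    _ ≤ (1 + (a / b) ^ 2) / 2 * ‖α • u + β • t‖ := by gcongr

theorem isCompact_planeProjection (K : ConvexBody (Eu n)) (x u t : Eu n) :
    IsCompact (planeProjection K x u t) :=
  K.isCompact.image (by fun_prop)

theorem mem_planeProjection_iff (hu : ‖u‖ = 1) (ht : ‖t‖ = 1) (htu : inner ℝ t u = 0) :
    x + a • u + b • t ∈ planeProjection K x u t ↔
      ∃ y ∈ K, inner ℝ (y - x) u = a ∧ inner ℝ (y - x) t = b := by
  simp only [planeProjection, starProjection_span_pair hu ht htu, add_assoc, add_right_inj,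
    Set.mem_image, SetLike.mem_coe]
  refine exists_congr fun y => and_congr_right fun _ => ⟨fun h => ?_, ?_⟩
  · have hleft := congrArg (inner ℝ · u) h
    have hright := congrArg (inner ℝ · t) h
    simp only [inner_smul_add_smul_left hu htu] at hleft
    simp only [inner_smul_add_smul_right ht htu] at hright
    exact ⟨hleft, hright⟩
  · rintro ⟨rfl, rfl⟩
    rfl

theorem mem_planeProjection_of_mem (hu : ‖u‖ = 1) (ht : ‖t‖ = 1) (htu : inner ℝ t u = 0)
    (h : x + a • u + b • t ∈ K) : x + a • u + b • t ∈ planeProjection K x u t := by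
  refine (mem_planeProjection_iff hu ht htu).2 ⟨_, h, ?_⟩
  rw [add_assoc, add_sub_cancel_left]
  exact ⟨inner_smul_add_smul_left hu htu a b, inner_smul_add_smul_right ht htu a b⟩

theorem planeProjection_subset_mk' (K : ConvexBody (Eu n)) (x u t : Eu n) :
    planeProjection K x u t ⊆ AffineSubspace.mk' x (Submodule.span ℝ {u, t}) := by
  rintro _ ⟨y, -, rfl⟩
  rw [SetLike.mem_coe, AffineSubspace.mem_mk', vsub_eq_sub, add_sub_cancel_left]
  exact Submodule.starProjection_apply_mem _ _

theorem exists_eq_of_mem_mk'_span_pair {z : Eu n}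
    (hz : z ∈ AffineSubspace.mk' x (Submodule.span ℝ {u, t})) :
    ∃ a b : ℝ, z = x + a • u + b • t := by
  obtain ⟨a, b, hab⟩ := Submodule.mem_span_pair.1 hz
  exact ⟨a, b, by rw [add_assoc, hab, vsub_eq_sub, add_sub_cancel]⟩

theorem sq_add_sq_le_one_of_mem_planeProjection (hu : ‖u‖ = 1) (ht : ‖t‖ = 1)
    (htu : inner ℝ t u = 0) (hK : ∀ y ∈ K, ‖y - (x - u)‖ ≤ 1)
    (h : x + a • u + b • t ∈ planeProjection K x u t) : (a + 1) ^ 2 + b ^ 2 ≤ 1 := by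
  obtain ⟨y, hy, rfl, rfl⟩ := (mem_planeProjection_iff hu ht htu).1 h
  have hyu : inner ℝ (y - (x - u)) u = inner ℝ (y - x) u + 1 := by
    rw [← sub_add, inner_add_left, real_inner_self_eq_norm_sq, hu, one_pow]
  have hyt : inner ℝ (y - (x - u)) t = inner ℝ (y - x) t := by
    rw [← sub_add, inner_add_left, real_inner_comm t u, htu, add_zero]
  rw [← hyu, ← hyt]
  exact (inner_sq_add_inner_sq_le hu ht htu _).trans (pow_le_one₀ (norm_nonneg _) (hK y hy))

/-- The point furthest out in direction `u` among the points of `K` with the same `t`-coordinate as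
`y` is projected to the relative boundary. -/
theorem exists_mem_intrinsicFrontier_planeProjection (hu : ‖u‖ = 1) (ht : ‖t‖ = 1)
    (htu : inner ℝ t u = 0) (hx : IsNormalAt (K : Set (Eu n)) x u) (hxu : x - u ∈ K) {y : Eu n}
    (hy : y ∈ K) (hyt : 0 < inner ℝ (y - x) t) :
    ∃ z ∈ openHalfplane x u t ∩ intrinsicFrontier ℝ (planeProjection K x u t),
      ‖z - x‖ ≤ ‖y - x‖ := by
  set P := planeProjection K x u t
  set b := inner ℝ (y - x) t
  have hslice : IsCompact ((K : Set (Eu n)) ∩ {w | inner ℝ (w - x) t = b}) :=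
    K.isCompact.inter_right (isClosed_eq (by fun_prop) continuous_const)
  obtain ⟨q, ⟨hq, hqt⟩, hmax⟩ := exists_isNormalAt hslice ⟨y, hy, rfl⟩ u
  set c := inner ℝ (q - x) u with hc
  have hyc : inner ℝ (y - x) u ≤ c := by
    rw [hc, inner_sub_left, inner_sub_left]
    exact sub_le_sub_right (hmax y ⟨hy, rfl⟩) _
  have hc0 : c ≤ 0 := by
    rw [hc, inner_sub_left]
    exact sub_nonpos.2 (hx.2 q hq)
  have hcP : x + c • u + b • t ∈ P := (mem_planeProjection_iff hu ht htu).2 ⟨q, hq, rfl, hqt⟩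
  have hspan : u ∈ (affineSpan ℝ P).direction := by
    have hxP : x + (0 : ℝ) • u + (0 : ℝ) • t ∈ P :=
      mem_planeProjection_of_mem hu ht htu (by simpa using hx.1)
    have hxuP : x + (-1 : ℝ) • u + (0 : ℝ) • t ∈ P :=
      mem_planeProjection_of_mem hu ht htu (by simpa [← sub_eq_add_neg] using hxu)
    simpa using AffineSubspace.vsub_mem_direction (subset_affineSpan ℝ P hxP)
      (subset_affineSpan ℝ P hxuP)
  refine ⟨_, ⟨⟨c, b, hyt, rfl⟩, mem_intrinsicFrontier_of_ray hcP (d := u) (fun r => ?_)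
    fun r hr hmem => ?_⟩, ?_⟩
  · rw [add_comm]
    exact AffineSubspace.vadd_mem_of_mem_direction (Submodule.smul_mem _ r hspan)
      (subset_affineSpan ℝ P hcP)
  · rw [add_right_comm, add_assoc x, ← add_smul] at hmem
    obtain ⟨q', hq', hq'u, hq't⟩ := (mem_planeProjection_iff hu ht htu).1 hmem
    have hle := hmax q' ⟨hq', hq't⟩
    rw [hc, inner_sub_left, inner_sub_left] at hq'u
    linarith
  · rw [add_assoc, add_sub_cancel_left, ← sq_le_sq₀ (norm_nonneg _) (norm_nonneg _),
      norm_smul_add_smul_sq hu ht htu]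
    calc c ^ 2 + b ^ 2 ≤ inner ℝ (y - x) u ^ 2 + b ^ 2 := by nlinarith
      _ ≤ ‖y - x‖ ^ 2 := inner_sq_add_inner_sq_le hu ht htu _

/-- Points of the plane that are close to `x` and inside the unit ball about `x - u` are points of
`K`, and hence of its projection. -/
theorem eventually_one_le_norm_of_mem_intrinsicFrontier (hu : ‖u‖ = 1) (ht : ‖t‖ = 1)
    (htu : inner ℝ t u = 0) (hK : ∀ᶠ y in 𝓝 x, ‖y - (x - u)‖ ≤ 1 → y ∈ K) :
    ∀ᶠ z in 𝓝 x, z ∈ intrinsicFrontier ℝ (planeProjection K x u t) → 1 ≤ ‖z - (x - u)‖ := by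
  filter_upwards [hK.eventually_nhds] with z hz hzfrontier
  by_contra! hlt
  have hnear : ∀ᶠ y in 𝓝 z, ‖y - (x - u)‖ < 1 :=
    ContinuousAt.eventually_lt (by fun_prop) continuousAt_const hlt
  refine notMem_intrinsicFrontier_of_inter_subset (planeProjection_subset_mk' K x u t)
    (hz.and hnear) ?_ hzfrontier
  rintro y ⟨⟨hyK, hy⟩, hyL⟩
  obtain ⟨a, b, rfl⟩ := exists_eq_of_mem_mk'_span_pair hyL
  exact mem_planeProjection_of_mem hu ht htu (hyK hy.le)

end PlaneProjection

section TangentialRadius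

namespace HasConstantWidth

variable {n : ℕ} {K : ConvexBody (Eu n)} {x u t w : Eu n}

theorem exists_mem_inner_pos (hK : HasConstantWidth K 1) (hu : ‖u‖ = 1) (ht : ‖t‖ = 1)
    (htu : inner ℝ t u = 0) (hx : IsNormalAt (K : Set (Eu n)) x u) :
    ∃ y ∈ K, 0 < inner ℝ (y - x) t := by
  by_contra! hnonpos
  have hxt : IsNormalAt (K : Set (Eu n)) x t :=
    ⟨hx.1, fun y hy => by simpa only [inner_sub_left, sub_nonpos] using hnonpos y hy⟩
  have := hK.half_le_inner hu ht hx hxt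
  linarith

theorem neBot_nhdsWithin_intrinsicFrontier (hK : HasConstantWidth K 1) (hu : ‖u‖ = 1)
    (ht : ‖t‖ = 1) (htu : inner ℝ t u = 0) (hx : IsNormalAt (K : Set (Eu n)) x u) :
    (𝓝[openHalfplane x u t ∩ intrinsicFrontier ℝ (planeProjection K x u t)] x).NeBot := by
  rw [← mem_closure_iff_nhdsWithin_neBot, Metric.mem_closure_iff]
  intro ε hε
  obtain ⟨y, hy, hyt⟩ := hK.exists_mem_inner_pos hu ht htu hx
  have hlim : Tendsto (fun s : ℝ => ‖x + s • (y - x) - x‖) (𝓝[>] 0) (𝓝 0) := by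
    have hcont : Continuous fun s : ℝ => ‖x + s • (y - x) - x‖ := by fun_prop
    simpa using (hcont.tendsto 0).mono_left nhdsWithin_le_nhds
  obtain ⟨s, hsε, hs⟩ := ((hlim.eventually_lt_const hε).and (Ioo_mem_nhdsGT one_pos)).exists
  have hsy : 0 < inner ℝ (x + s • (y - x) - x) t := by
    rw [add_sub_cancel_left, real_inner_smul_left]
    exact mul_pos hs.1 hyt
  obtain ⟨z, hz, hzx⟩ := exists_mem_intrinsicFrontier_planeProjection hu ht htu hx
    (hK.sub_mem hu hx) (K.convex.add_smul_sub_mem hx.1 hy (Set.Ioo_subset_Icc_self hs)) hsy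
  exact ⟨z, hz, by rw [dist_comm, dist_eq_norm]; exact hzx.trans_lt hsε⟩

theorem tangentialRadiusEq_of_tendsto (hK : HasConstantWidth K 1) (hu : ‖u‖ = 1) (ht : ‖t‖ = 1)
    (htu : inner ℝ t u = 0) (hx : IsNormalAt (K : Set (Eu n)) x u) {r : ℝ≥0∞}
    (h : Tendsto (circleRadius x u)
      (𝓝[openHalfplane x u t ∩ intrinsicFrontier ℝ (planeProjection K x u t)] x) (𝓝 r)) :
    TangentialRadiusEq K u t r :=
  haveI := hK.neBot_nhdsWithin_intrinsicFrontier hu ht htu hx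
  ⟨x, hK.supportSet_eq_singleton hu hx, h.liminf_eq, h.limsup_eq⟩

/-- The radius vanishes in the direction `t` in which `w` is inclined from `u`: the normal vector
`w` forces the projection to have a corner at `x`. -/
theorem exists_tangentialRadiusEq_zero (hK : HasConstantWidth K 1) (hu : ‖u‖ = 1) (hw : ‖w‖ = 1)
    (hxu : IsNormalAt (K : Set (Eu n)) x u) (hxw : IsNormalAt (K : Set (Eu n)) x w) (hwu : w ≠ u) :
    ∃ t : Eu n, ‖t‖ = 1 ∧ inner ℝ t u = 0 ∧ TangentialRadiusEq K u t 0 := by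
  have ha : 0 ≤ inner ℝ w u := by linarith [hK.half_le_inner hu hw hxu hxw]
  have hne : w ≠ inner ℝ w u • u := by
    intro heq
    have hnorm := congrArg norm heq
    rw [hw, norm_smul, hu, mul_one, Real.norm_of_nonneg ha] at hnorm
    rw [← hnorm, one_smul] at heq
    exact hwu heq
  obtain ⟨t, ht, htu, b, hb, hwt⟩ := exists_orthonormal_eq_add_smul hu hne
  refine ⟨t, ht, htu, hK.tangentialRadiusEq_of_tendsto hu ht htu hxu ?_⟩
  have hlim : Tendsto (fun z => ENNReal.ofReal ((1 + (inner ℝ w u / b) ^ 2) / 2 * ‖z - x‖))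
      (𝓝 x) (𝓝 0) := by
    have hcont : Continuous fun z => (1 + (inner ℝ w u / b) ^ 2) / 2 * ‖z - x‖ := by fun_prop
    simpa [Function.comp_def] using (ENNReal.continuous_ofReal.comp hcont).tendsto x
  refine tendsto_of_tendsto_of_tendsto_of_le_of_le' tendsto_const_nhds
    (hlim.mono_left nhdsWithin_le_nhds) (Eventually.of_forall fun _ => zero_le) ?_
  filter_upwards [self_mem_nhdsWithin]
  rintro _ ⟨⟨α, β, hβ, rfl⟩, hfrontier⟩
  obtain ⟨y, hy, rfl, rfl⟩ := (mem_planeProjection_iff hu ht htu).1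
    (intrinsicFrontier_subset (isCompact_planeProjection K x u t).isClosed hfrontier)
  have hsupport : inner ℝ (y - x) w ≤ 0 := by
    rw [inner_sub_left]
    exact sub_nonpos.2 (hxw.2 y hy)
  rw [hwt, inner_add_right, real_inner_smul_right, real_inner_smul_right] at hsupport
  rw [add_assoc, add_sub_cancel_left, ← add_assoc]
  exact circleRadius_le hu ht htu ha hb hβ hsupport

theorem tangentialRadiusEq_one (hK : HasConstantWidth K 1) (hu : ‖u‖ = 1) (ht : ‖t‖ = 1)
    (htu : inner ℝ t u = 0) (hx : IsNormalAt (K : Set (Eu n)) x u)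
    (hcap : ∀ᶠ y in 𝓝 x, ‖y - (x - u)‖ = 1 → y ∈ K) : TangentialRadiusEq K u t 1 := by
  refine hK.tangentialRadiusEq_of_tendsto hu ht htu hx (tendsto_const_nhds.congr' ?_)
  have hxc : ‖x - (x - u)‖ = 1 := by rwa [sub_sub_cancel]
  have hne : x ≠ x - u := fun h => by simp [← h] at hxc
  have hball := eventually_mem_of_eventually_mem_sphere K.convex (hK.sub_mem hu hx) hne
    (by rwa [hxc])
  rw [hxc] at hball
  filter_upwards [self_mem_nhdsWithin, nhdsWithin_le_nhds
    (eventually_one_le_norm_of_mem_intrinsicFrontier hu ht htu hball)]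
  rintro _ ⟨⟨α, β, hβ, rfl⟩, hfrontier⟩ hge
  have hle : (α + 1) ^ 2 + β ^ 2 ≤ 1 := sq_add_sq_le_one_of_mem_planeProjection hu ht htu
    (fun y hy => hK.norm_sub_le hy (hK.sub_mem hu hx))
    (intrinsicFrontier_subset (isCompact_planeProjection K x u t).isClosed hfrontier)
  have hcoord : x + α • u + β • t - (x - u) = (α + 1) • u + β • t := by module
  have hsq : 1 ≤ (α + 1) ^ 2 + β ^ 2 := by
    rw [← norm_smul_add_smul_sq hu ht htu, ← hcoord]
    exact one_le_pow₀ (hge hfrontier)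
  have hα : α < 0 := by nlinarith [sq_nonneg α, pow_pos hβ 2]
  rw [circleRadius_eq hu ht htu hα, eq_comm, ENNReal.ofReal_eq_one, div_eq_one_iff_eq (by linarith)]
  linarith

end HasConstantWidth

end TangentialRadius

section Rounding

theorem hausdorffDist_combination_le {F : Type*} [NormedAddCommGroup F] [NormedSpace ℝ F]
    {K L : ConvexBody F} {D l : ℝ} (hD : ∀ x ∈ K, ∀ y ∈ L, ‖x - y‖ ≤ D)
    (hl : l ∈ Set.Icc (0 : ℝ) 1) :
    Metric.hausdorffDist (K : Set F) ((1 - l) • K + l • L : ConvexBody F) ≤ l * D := by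
  obtain ⟨x₀, hx₀⟩ := K.nonempty
  obtain ⟨y₀, hy₀⟩ := L.nonempty
  have hdist : ∀ x ∈ K, ∀ y ∈ L, dist x ((1 - l) • x + l • y) ≤ l * D := by
    intro x hx y hy
    have hsub : x - ((1 - l) • x + l • y) = l • (x - y) := by module
    rw [dist_eq_norm, hsub, norm_smul, Real.norm_of_nonneg hl.1]
    exact mul_le_mul_of_nonneg_left (hD x hx y hy) hl.1
  have hD0 : 0 ≤ l * D := mul_nonneg hl.1 ((norm_nonneg _).trans (hD x₀ hx₀ y₀ hy₀))
  refine Metric.hausdorffDist_le_of_mem_dist hD0 (fun x hx => ?_) ?_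
  · exact ⟨(1 - l) • x + l • y₀, Set.add_mem_add (Set.smul_mem_smul_set hx)
      (Set.smul_mem_smul_set hy₀), hdist x hx y₀ hy₀⟩
  · rintro _ ⟨_, ⟨x, hx, rfl⟩, _, ⟨y, hy, rfl⟩, rfl⟩
    exact ⟨x, hx, by rw [dist_comm]; exact hdist x hx y hy⟩

variable {n : ℕ} {K : ConvexBody (Eu n)} {c p q u w : Eu n} {l : ℝ}

/-- The Minkowski combination `(1 - l) K + l B` of `K` and the ball `B` of diameter one with
centre `c`, a smooth approximation of `K` for small `l > 0`. -/
noncomputable def rounding (K : ConvexBody (Eu n)) (c : Eu n) (l : ℝ) : ConvexBody (Eu n) :=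
  (1 - l) • K + l • closedBallBody c one_half_pos.le

theorem IsNormalAt.exists_eq_of_rounding (hu : ‖u‖ = 1) (hl : 0 < l)
    (hp : IsNormalAt (rounding K c l : Set (Eu n)) p u) :
    ∃ x ∈ K, p = (1 - l) • x + l • (c + (1 / 2 : ℝ) • u) := by
  obtain ⟨⟨_, ⟨x, hx, rfl⟩, _, ⟨b, hb, rfl⟩, rfl⟩, hmax⟩ := hp
  have hbu : IsNormalAt (Metric.closedBall c (1 / 2)) b u := by
    refine ⟨hb, fun y hy => ?_⟩
    have hle := hmax ((1 - l) • x + l • y)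
      (Set.add_mem_add (Set.smul_mem_smul_set hx) (Set.smul_mem_smul_set hy))
    simpa only [inner_add_left, real_inner_smul_left, add_le_add_iff_left,
      mul_le_mul_iff_right₀ hl] using hle
  exact ⟨x, hx, by rw [← hbu.eq_of_closedBall one_half_pos.le hu]⟩

namespace HasConstantWidth

theorem rounding (hK : HasConstantWidth K 1) (c : Eu n) (hl : l ∈ Set.Icc (0 : ℝ) 1) :
    HasConstantWidth (rounding K c l) 1 := by
  have h := (hK.smul (sub_nonneg.2 hl.2)).add
    ((hasConstantWidth_closedBallBody c one_half_pos.le).smul hl.1)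
  rwa [add_halves, ← add_mul, sub_add_cancel, mul_one] at h

theorem hausdorffDist_rounding_le (hK : HasConstantWidth K 1) (hc : c ∈ K)
    (hl : l ∈ Set.Icc (0 : ℝ) 1) :
    Metric.hausdorffDist (K : Set (Eu n)) (ConstWidth.rounding K c l) ≤ l * (1 + 1 / 2) := by
  refine hausdorffDist_combination_le (fun x hx y hy => ?_) hl
  calc ‖x - y‖ ≤ ‖x - c‖ + ‖c - y‖ := norm_sub_le_norm_sub_add_norm_sub x c y
    _ ≤ 1 + 1 / 2 :=
      add_le_add (hK.norm_sub_le hx hc) (by rw [norm_sub_rev]; exact mem_closedBall_iff_norm.1 hy)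

theorem norm_sub_le_of_isNormalAt_rounding (hK : HasConstantWidth K 1) (hu : ‖u‖ = 1)
    (hw : ‖w‖ = 1) (hl : l ∈ Set.Ioc (0 : ℝ) 1)
    (hp : IsNormalAt (ConstWidth.rounding K c l : Set (Eu n)) p u)
    (hq : IsNormalAt (ConstWidth.rounding K c l : Set (Eu n)) q w) :
    ‖p - q‖ ≤ 1 - l * (1 - ‖u - w‖ / 2) := by
  obtain ⟨x, hx, rfl⟩ := hp.exists_eq_of_rounding hu hl.1
  obtain ⟨y, hy, rfl⟩ := hq.exists_eq_of_rounding hw hl.1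
  have hsub : (1 - l) • x + l • (c + (1 / 2 : ℝ) • u) - ((1 - l) • y + l • (c + (1 / 2 : ℝ) • w)) =
      (1 - l) • (x - y) + (l / 2) • (u - w) := by module
  rw [hsub]
  calc ‖(1 - l) • (x - y) + (l / 2) • (u - w)‖ ≤ (1 - l) * ‖x - y‖ + l / 2 * ‖u - w‖ := by
        refine (norm_add_le _ _).trans_eq ?_
        rw [norm_smul, norm_smul, Real.norm_of_nonneg (sub_nonneg.2 hl.2),
          Real.norm_of_nonneg (half_pos hl.1).le]
    _ ≤ (1 - l) * 1 + l / 2 * ‖u - w‖ := by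
        gcongr
        · exact sub_nonneg.2 hl.2
        · exact hK.norm_sub_le hx hy
    _ = 1 - l * (1 - ‖u - w‖ / 2) := by ring

theorem exists_norm_sub_le_of_mem_reverseSphericalImage (hK : HasConstantWidth K 1)
    {N : Set (Eu n)} (hN : ∀ u ∈ N, ‖u‖ = 1) {γ : ℝ} (hγ : 0 < γ)
    (hNγ : ∀ u ∈ N, ∀ w ∈ N, ‖u - w‖ ≤ 2 - γ) {ε : ℝ} (hε : 0 < ε) :
    ∃ R : ConvexBody (Eu n), HasConstantWidth R 1 ∧ Metric.hausdorffDist (K : Set (Eu n)) R ≤ ε ∧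
      ∃ η > 0, ∀ p ∈ reverseSphericalImage (R : Set (Eu n)) N,
        ∀ q ∈ reverseSphericalImage (R : Set (Eu n)) N, ‖p - q‖ ≤ 1 - η := by
  obtain ⟨c, hc⟩ := K.nonempty
  obtain ⟨l, hl, hlε⟩ : ∃ l ∈ Set.Ioc (0 : ℝ) 1, l * (1 + 1 / 2) ≤ ε :=
    ⟨min 1 (ε / 2), ⟨by positivity, min_le_left _ _⟩, by linarith [min_le_right 1 (ε / 2)]⟩
  have hl' := Set.Ioc_subset_Icc_self hl
  refine ⟨ConstWidth.rounding K c l, hK.rounding c hl',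
    (hK.hausdorffDist_rounding_le hc hl').trans hlε, l * (γ / 2), mul_pos hl.1 (half_pos hγ), ?_⟩
  rintro p ⟨u, hu, hp⟩ q ⟨w, hw, hq⟩
  refine (hK.norm_sub_le_of_isNormalAt_rounding (hN u hu) (hN w hw) hl hp hq).trans ?_
  have := hl.1.le
  gcongr
  linarith [hNγ u hu w hw]

end HasConstantWidth

end Rounding

section FiniteApproximation

variable {n : ℕ} {K Q : ConvexBody (Eu n)} {N X : Set (Eu n)} {p x u : Eu n} {δ ε η : ℝ}

namespace HasConstantWidth

theorem subset_ballDual_of_subset (hK : HasConstantWidth K 1) (hX : X ⊆ K) :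
    (K : Set (Eu n)) ⊆ ballDual X :=
  fun _ hx => mem_ballDual.2 fun _ hy => hK.norm_sub_le hx (hX hy)

theorem norm_sub_sq_le_of_isNormalAt_ballDual (hK : HasConstantWidth K 1) (hX : X ⊆ K)
    (hnet : ∀ s ∈ K, ∃ i ∈ X, ‖s - i‖ ≤ δ) (hu : ‖u‖ = 1) (hp : IsNormalAt (ballDual X) p u)
    (hx : IsNormalAt (K : Set (Eu n)) x u) : ‖p - x‖ ^ 2 ≤ 2 * δ + δ ^ 2 :=
  norm_sub_sq_le_of_inner_le hu (hp.2 x (hK.subset_ballDual_of_subset hX hx.1))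
    (norm_sub_le_of_mem_ballDual hnet hp.1 (hK.sub_mem hu hx))

theorem exists_finite_norm_sub_le_one (hK : HasConstantWidth K 1) (hε : 0 < ε) (hη : 0 < η)
    (hN : ∀ u ∈ N, ‖u‖ = 1) (hKN : ∀ p ∈ reverseSphericalImage (K : Set (Eu n)) N,
      ∀ q ∈ reverseSphericalImage (K : Set (Eu n)) N, ‖p - q‖ ≤ 1 - η) :
    ∃ X ⊆ (K : Set (Eu n)), X.Finite ∧ (∀ s ∈ K, ∃ x ∈ X, ‖s - x‖ ≤ ε) ∧
      (∀ z ∈ ballDual X, ∃ s ∈ K, ‖z - s‖ ≤ ε) ∧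
      ∀ p ∈ reverseSphericalImage (ballDual X) N, ∀ q ∈ reverseSphericalImage (ballDual X) N,
        ‖p - q‖ ≤ 1 := by
  obtain ⟨δ, hδη, hδ0, hδε⟩ : ∃ δ : ℝ, 2 * δ + δ ^ 2 < (η / 2) ^ 2 ∧ 0 < δ ∧ δ < ε := by
    have hlim : Tendsto (fun δ : ℝ => 2 * δ + δ ^ 2) (𝓝[>] 0) (𝓝 0) := by
      have hcont : Continuous fun δ : ℝ => 2 * δ + δ ^ 2 := by fun_prop
      simpa using (hcont.tendsto 0).mono_left nhdsWithin_le_nhds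
    exact ((hlim.eventually_lt_const (by positivity)).and (Ioo_mem_nhdsGT hε)).exists
  obtain ⟨X, hXK, hXfin, hcover⟩ := K.isCompact.finite_cover_balls hδ0
  have hnet : ∀ s ∈ K, ∃ x ∈ X, ‖s - x‖ ≤ δ := by
    intro s hs
    obtain ⟨x, hx, hsx⟩ := Set.mem_iUnion₂.1 (hcover hs)
    exact ⟨x, hx, (mem_ball_iff_norm.1 hsx).le⟩
  refine ⟨X, hXK, hXfin, fun s hs => ?_, fun z hz => ?_, ?_⟩
  · obtain ⟨x, hx, hsx⟩ := hnet s hs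
    exact ⟨x, hx, hsx.trans hδε.le⟩
  · obtain ⟨s, hs, hzs⟩ := hK.exists_mem_norm_sub_le hδ0.le
      fun y hy => norm_sub_le_of_mem_ballDual hnet hz hy
    exact ⟨s, hs, hzs.trans hδε.le⟩
  have hclose : ∀ p ∈ reverseSphericalImage (ballDual X) N,
      ∃ x ∈ reverseSphericalImage (K : Set (Eu n)) N, ‖p - x‖ ≤ η / 2 := by
    rintro p ⟨u, hu, hp⟩
    obtain ⟨x, hx⟩ := exists_isNormalAt_convexBody K u
    have hsq := hK.norm_sub_sq_le_of_isNormalAt_ballDual hXK hnet (hN u hu) hp hx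
    exact ⟨x, ⟨u, hu, hx⟩,
      (sq_le_sq₀ (norm_nonneg _) (half_pos hη).le).1 (hsq.trans hδη.le)⟩
  intro p hp q hq
  obtain ⟨x, hx, hpx⟩ := hclose p hp
  obtain ⟨y, hy, hqy⟩ := hclose q hq
  calc ‖p - q‖ ≤ ‖p - x‖ + ‖x - y‖ + ‖y - q‖ := by
        simpa only [dist_eq_norm] using dist_triangle4 p x y q
    _ ≤ η / 2 + (1 - η) + η / 2 := by
        rw [norm_sub_rev y q]
        gcongr
        exact hKN x hx y hy
    _ = 1 := by ring

end HasConstantWidth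

theorem exists_hasConstantWidth_of_norm_sub_le_one (hne : X.Nonempty) (hX : X ⊆ ballDual X)
    (hXN : ∀ p ∈ reverseSphericalImage (ballDual X) N,
      ∀ q ∈ reverseSphericalImage (ballDual X) N, ‖p - q‖ ≤ 1) :
    ∃ Q : ConvexBody (Eu n), HasConstantWidth Q 1 ∧ X ⊆ Q ∧
      reverseSphericalImage (ballDual X) N ⊆ Q := by
  obtain ⟨Q, hQ, hwidth⟩ := exists_superset_hasConstantWidth_one
    (S := X ∪ reverseSphericalImage (ballDual X) N) (hne.mono Set.subset_union_left) (by
      intro p hp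
      refine mem_ballDual.2 fun q hq => ?_
      rcases hp with hp | hp <;> rcases hq with hq | hq
      · exact mem_ballDual.1 (hX hp) q hq
      · obtain ⟨u, -, hq⟩ := hq
        rw [norm_sub_rev]
        exact mem_ballDual.1 hq.1 p hp
      · obtain ⟨u, -, hp⟩ := hp
        exact mem_ballDual.1 hp.1 q hq
      · exact hXN p hp q hq)
  exact ⟨Q, hwidth, Set.subset_union_left.trans hQ, Set.subset_union_right.trans hQ⟩

theorem HasConstantWidth.exists_reverseSphericalImage_ballDual_subset (hK : HasConstantWidth K 1)
    (hε : 0 < ε) (hη : 0 < η) (hN : ∀ u ∈ N, ‖u‖ = 1)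
    (hKN : ∀ p ∈ reverseSphericalImage (K : Set (Eu n)) N,
      ∀ q ∈ reverseSphericalImage (K : Set (Eu n)) N, ‖p - q‖ ≤ 1 - η) :
    ∃ (X : Set (Eu n)) (Q : ConvexBody (Eu n)), X.Finite ∧ X.Nonempty ∧ HasConstantWidth Q 1 ∧
      Metric.hausdorffDist (K : Set (Eu n)) Q ≤ ε ∧ X ⊆ Q ∧
      reverseSphericalImage (ballDual X) N ⊆ Q := by
  obtain ⟨X, hXK, hXfin, hnet, hnear, hXN⟩ := hK.exists_finite_norm_sub_le_one hε hη hN hKN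
  have hXne : X.Nonempty := by
    obtain ⟨s, hs⟩ := K.nonempty
    obtain ⟨x, hx, -⟩ := hnet s hs
    exact ⟨x, hx⟩
  obtain ⟨Q, hQ, hXQ, hNQ⟩ := exists_hasConstantWidth_of_norm_sub_le_one hXne
    (hXK.trans (hK.subset_ballDual_of_subset hXK)) hXN
  refine ⟨X, Q, hXfin, hXne, hQ, ?_, hXQ, hNQ⟩
  refine Metric.hausdorffDist_le_of_mem_dist hε.le (fun s hs => ?_) fun q hq => ?_
  · obtain ⟨x, hx, hsx⟩ := hnet s hs
    exact ⟨x, hXQ hx, by rwa [dist_eq_norm]⟩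
  · obtain ⟨s, hs, hqs⟩ := hnear q (hQ.subset_ballDual_of_subset hXQ hq)
    exact ⟨s, hs, by rwa [dist_eq_norm]⟩

theorem IsNormalAt.exists_norm_sub_eq_one (hX : X.Finite) (hu : u ≠ 0)
    (hx : IsNormalAt (ballDual X) x u) : ∃ i ∈ X, ‖x - i‖ = 1 := by
  by_contra! hinactive
  refine hx.notMem_interior hu (mem_interior_iff_mem_nhds.2 ?_)
  filter_upwards [eventually_mem_ballDual hX hx.1] with y hy
  exact hy fun i hi h => absurd h (hinactive i hi)

/-- The two cases are: `x` lies on the boundary of one of the unit balls forming `ballDual X` whose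
normal vector at `x` is not `u`, or near `x` the set `ballDual X` is the unit ball with centre
`x - u`. -/
theorem HasConstantWidth.tangentialRadiusEq_one_or_exists_zero (hQ : HasConstantWidth Q 1)
    (hXfin : X.Finite) (hXne : X.Nonempty) (hXQ : X ⊆ Q)
    (hXN : reverseSphericalImage (ballDual X) N ⊆ Q) (hu : ‖u‖ = 1)
    (hN : ∀ᶠ w in 𝓝 u, ‖w‖ = 1 → w ∈ N) :
    (∀ t : Eu n, ‖t‖ = 1 → inner ℝ t u = 0 → TangentialRadiusEq Q u t 1) ∨
      ∃ t : Eu n, ‖t‖ = 1 ∧ inner ℝ t u = 0 ∧ TangentialRadiusEq Q u t 0 := by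
  have hQX := hQ.subset_ballDual_of_subset hXQ
  have hball : ∀ i ∈ X, ballDual X ⊆ Metric.closedBall i 1 :=
    fun i hi => Set.biInter_subset_of_mem hi
  obtain ⟨x, hx⟩ := exists_isNormalAt (isCompact_ballDual hXne) (Q.nonempty.mono hQX) u
  have hxQ : IsNormalAt (Q : Set (Eu n)) x u :=
    hx.mono hQX (hXN ⟨u, hN.self_of_nhds hu, hx⟩)
  by_cases hother : ∃ i ∈ X, ‖x - i‖ = 1 ∧ x - i ≠ u
  · right
    obtain ⟨i, hi, hxi, hne⟩ := hother
    have hxQi : IsNormalAt (Q : Set (Eu n)) x (x - i) :=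
      isNormalAt_of_subset_closedBall (hQX.trans (hball i hi)) hxQ.1 hxi (one_smul ℝ _).symm
    exact hQ.exists_tangentialRadiusEq_zero hu hxi hxQ hxQi hne
  · left
    intro t ht htu
    push Not at hother
    have hactive : ∀ i ∈ X, ‖x - i‖ = 1 → i = x - u :=
      fun i hi hxi => by rw [← hother i hi hxi, sub_sub_cancel]
    have hcentre : x - u ∈ X := by
      obtain ⟨i, hi, hxi⟩ := hx.exists_norm_sub_eq_one hXfin (norm_ne_zero_iff.1 (by simp [hu]))
      exact hactive i hi hxi ▸ hi
    have hlim : Tendsto (fun y => y - (x - u)) (𝓝 x) (𝓝 u) := by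
      have hcont : Continuous fun y => y - (x - u) := by fun_prop
      simpa using hcont.tendsto x
    refine hQ.tangentialRadiusEq_one hu ht htu hxQ ?_
    filter_upwards [eventually_mem_ballDual hXfin hx.1, hlim.eventually hN] with y hyX hyN hy
    have hydual : y ∈ ballDual X := hyX fun i hi hxi => by rw [hactive i hi hxi, hy]
    exact hXN ⟨y - (x - u), hyN hy,
      isNormalAt_of_subset_closedBall (hball _ hcentre) hydual hy (one_smul ℝ _).symm⟩

end FiniteApproximation

section Antipodal

theorem exists_forall_norm_sub_le_two_sub {E : Type*} [NormedAddCommGroup E]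
    [InnerProductSpace ℝ E] {C : Set E} (hC : IsCompact C)
    (hunit : ∀ u ∈ C, ‖u‖ = 1) (hneg : ∀ u ∈ C, -u ∉ C) :
    ∃ γ > 0, ∀ u ∈ C, ∀ w ∈ C, ‖u - w‖ ≤ 2 - γ := by
  rcases C.eq_empty_or_nonempty with rfl | hne
  · exact ⟨1, one_pos, by simp⟩
  obtain ⟨⟨u₀, w₀⟩, ⟨hu₀, hw₀⟩, hmax⟩ := (hC.prod hC).exists_isMaxOn (hne.prod hne)
    (f := fun p => ‖p.1 - p.2‖) (by fun_prop)
  refine ⟨2 - ‖u₀ - w₀‖, ?_, fun u hu w hw => ?_⟩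
  · have hsum : 0 < ‖u₀ + w₀‖ ^ 2 := by
      have : u₀ + w₀ ≠ 0 := fun h => hneg u₀ hu₀ (neg_eq_of_add_eq_zero_right h ▸ hw₀)
      positivity
    have hlaw := parallelogram_law_with_norm ℝ u₀ w₀
    rw [hunit u₀ hu₀, hunit w₀ hw₀] at hlaw
    have : ‖u₀ - w₀‖ ^ 2 < 2 ^ 2 := by linarith
    exact sub_pos.2 ((sq_lt_sq₀ (norm_nonneg _) two_pos.le).1 this)
  · rw [sub_sub_cancel]
    exact hmax (Set.mk_mem_prod hu hw)

theorem norm_sub_le_of_mem_thickening {F : Type*} [NormedAddCommGroup F] {C : Set F} {γ : ℝ}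
    (hC : ∀ u ∈ C, ∀ w ∈ C, ‖u - w‖ ≤ 2 - γ) {u w : F} (hu : u ∈ Metric.thickening (γ / 4) C)
    (hw : w ∈ Metric.thickening (γ / 4) C) : ‖u - w‖ ≤ 2 - γ / 2 := by
  obtain ⟨u', hu', huu'⟩ := Metric.mem_thickening_iff.1 hu
  obtain ⟨w', hw', hww'⟩ := Metric.mem_thickening_iff.1 hw
  have htriangle := dist_triangle4 u u' w' w
  rw [dist_comm w' w, dist_eq_norm u' w', dist_eq_norm u w] at htriangle
  linarith [hC u' hu' w' hw']

end Antipodal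

end ConstWidth

open ConstWidth in
theorem mainTheorem4_general (n : ℕ) (W₀ : ConvexBody (Eu n)) (hW₀ : HasConstantWidth W₀ 1)
    (C : Set (Eu n)) (hC : IsClosed C) (hunit : ∀ u ∈ C, ‖u‖ = 1) (hneg : ∀ u ∈ C, -u ∉ C)
    (ε : ℝ) (hε : 0 < ε) :
    ∃ Q : ConvexBody (Eu n), HasConstantWidth Q 1 ∧
      Metric.hausdorffDist (W₀ : Set (Eu n)) Q ≤ ε ∧
      ∀ u ∈ C, (∀ t : Eu n, ‖t‖ = 1 → inner ℝ t u = 0 → TangentialRadiusEq Q u t 1) ∨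
        ∃ t : Eu n, ‖t‖ = 1 ∧ inner ℝ t u = 0 ∧ TangentialRadiusEq Q u t 0 := by
  have hcompact : IsCompact C := (isCompact_closedBall 0 1).of_isClosed_subset hC
    fun u hu => by simp [hunit u hu]
  obtain ⟨γ, hγ, hCγ⟩ := exists_forall_norm_sub_le_two_sub hcompact hunit hneg
  set N := {w : Eu n | ‖w‖ = 1 ∧ w ∈ Metric.thickening (γ / 4) C}
  obtain ⟨R, hR, hWR, η, hη, hRN⟩ := hW₀.exists_norm_sub_le_of_mem_reverseSphericalImage
    (N := N) (fun u hu => hu.1) (half_pos hγ)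
    (fun u hu w hw => norm_sub_le_of_mem_thickening hCγ hu.2 hw.2) (half_pos hε)
  obtain ⟨X, Q, hXfin, hXne, hQ, hRQ, hXQ, hNQ⟩ :=
    hR.exists_reverseSphericalImage_ballDual_subset (half_pos hε) hη (fun u hu => hu.1) hRN
  refine ⟨Q, hQ, ?_, fun u hu => ?_⟩
  · rw [ConvexBody.hausdorffDist_coe] at hWR hRQ ⊢
    linarith [dist_triangle W₀ R Q]
  · refine hQ.tangentialRadiusEq_one_or_exists_zero hXfin hXne hXQ hNQ (hunit u hu) ?_
    filter_upwards [Metric.isOpen_thickening.mem_nhds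
      (Metric.self_subset_thickening (by positivity : 0 < γ / 4) C hu)] with w hw hw1
    exact ⟨hw1, hw⟩

theorem mainTheorem4 (n : ℕ) (W₀ : ConvexBody (EuclideanSpace ℝ (Fin n)))
    (hW₀ : ConstWidth.HasConstantWidth W₀ 1)
    (v : EuclideanSpace ℝ (Fin n)) (hv : ‖v‖ = 1) (ε : ℝ) (hε : 0 < ε) :
    ∃ Q : ConvexBody (EuclideanSpace ℝ (Fin n)),
      ConstWidth.HasConstantWidth Q 1 ∧
      Metric.hausdorffDist (W₀ : Set (EuclideanSpace ℝ (Fin n))) Q ≤ ε ∧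
      ∀ u : EuclideanSpace ℝ (Fin n), ‖u‖ = 1 → 1 / 2 ≤ inner ℝ u v →
        (∀ t : EuclideanSpace ℝ (Fin n), ‖t‖ = 1 → inner ℝ t u = 0 →
          ConstWidth.TangentialRadiusEq Q u t 1) ∨
        (∃ t : EuclideanSpace ℝ (Fin n), ‖t‖ = 1 ∧ inner ℝ t u = 0 ∧
          ConstWidth.TangentialRadiusEq Q u t 0) := by
  have hinner : Continuous fun u : EuclideanSpace ℝ (Fin n) => inner ℝ u v := by fun_prop
  have hclosed : IsClosed {u : EuclideanSpace ℝ (Fin n) | ‖u‖ = 1 ∧ 1 / 2 ≤ inner ℝ u v} :=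
    (isClosed_eq continuous_norm continuous_const).inter
      (isClosed_le continuous_const hinner)
  obtain ⟨Q, hQ, hdist, hradius⟩ := mainTheorem4_general n W₀ hW₀ _ hclosed (fun u hu => hu.1)
    (fun u hu hneg => by linarith [inner_neg_left (𝕜 := ℝ) u v, hu.2, hneg.2]) ε hε
  exact ⟨Q, hQ, hdist, fun u hu huv => hradius u ⟨hu, huv⟩⟩
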